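/- Let $\mathrm{MTL}$ be the monoidal t-norm based logic (over the connectives $\&,\wedge,\to,\bot$ and countably many variables) and let $L$ be an axiomatic extension of $\mathrm{MTL}$, i.e. a logic obtained from $\mathrm{MTL}$ by adding axiom schemata, with modus ponens as the only rule. An MTL-algebra is a bounded lattice $\langle A,\sqcap,\sqcup,0,1\rangle$ with a commutative monoid structure $\langle A,*,1\rangle$ and an operation $\Rightarrow$ such that $z*x\le y$ iff $z\le x\Rightarrow y$, and $(x\Rightarrow y)\sqcup(y\Rightarrow x)=1$. An $L$-algebra is an MTL-algebra in which every axiom of $L$ takes the value $1$ under every assignment; the $L$-algebras form the variety $\mathbb{L}$ corresponding to $L$. Say that - $L$ enjoys the single chain completeness (SCC) if there is a totally ordered $L$-algebra $\mathcal A$ such that, for every formula $\varphi$, $\vdash_L\varphi$ if and only if $\varphi$ takes the value $1$ under every assignment in $\mathcal A$; - $L$ enjoys the subdirect single chain completeness (subSCC) if there is a subdirectly irreducible $L$-algebra (the trivial algebra being counted as subdirectly irreducible) that is generic, i.e. generates the variety $\mathbb{L}$; - $L$ is $n$-contractive, for a positive integer $n$, if $\vdash_L\varphi^n\to\varphi^{n+1}$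 for every formula $\varphi$, where $\varphi^n=\varphi\,\&\cdots\&\,\varphi$ ($n$ factors). Suppose that $\mathbb{L}$ is locally finite, i.e. every finitely generated $L$-algebra is finite. Then $L$ is $n$-contractive for some positive integer $n$, and $L$ enjoys the SCC if and only if $L$ enjoys the subSCC. -/

import Mathlib

universe u

namespace MTL

/-- Formulas over the connectives `&`, `∧`, `→`, `⊥` and the variables `p₀, p₁, …`. -/
inductive Formula : Type
  | var : ℕ → Formula
  | bot : Formula
  | conj : Formula → Formula → Formula
  | meet : Formula → Formula → Formula
  | imp : Formula → Formula → Formula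

namespace Formula

/-- Simultaneous substitution of formulas for variables. -/
def subst (σ : ℕ → Formula) : Formula → Formula
  | var i => σ i
  | bot => bot
  | conj φ ψ => conj (φ.subst σ) (ψ.subst σ)
  | meet φ ψ => meet (φ.subst σ) (ψ.subst σ)
  | imp φ ψ => imp (φ.subst σ) (ψ.subst σ)

/-- The power `φⁿ = φ & ⋯ & φ` (`n` factors), with `φ⁰` the true formula `⊥ → ⊥`. -/
def pow (φ : Formula) : ℕ → Formula
  | 0 => imp bot bot
  | 1 => φ
  | n + 2 => conj (φ.pow (n + 1)) φ

end Formula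

open Formula in
/-- The axioms of the monoidal t-norm based logic MTL. -/
inductive MTLAxiom : Formula → Prop
  | a1 (φ ψ χ : Formula) : MTLAxiom (imp (imp φ ψ) (imp (imp ψ χ) (imp φ χ)))
  | a2 (φ ψ : Formula) : MTLAxiom (imp (conj φ ψ) φ)
  | a3 (φ ψ : Formula) : MTLAxiom (imp (conj φ ψ) (conj ψ φ))
  | a4 (φ ψ : Formula) : MTLAxiom (imp (meet φ ψ) φ)
  | a5 (φ ψ : Formula) : MTLAxiom (imp (meet φ ψ) (meet ψ φ))
  | a6 (φ ψ : Formula) : MTLAxiom (imp (conj φ (imp φ ψ)) (meet ψ φ))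
  | a7a (φ ψ χ : Formula) : MTLAxiom (imp (imp φ (imp ψ χ)) (imp (conj φ ψ) χ))
  | a7b (φ ψ χ : Formula) : MTLAxiom (imp (imp (conj φ ψ) χ) (imp φ (imp ψ χ)))
  | a8 (φ ψ χ : Formula) :
      MTLAxiom (imp (imp (imp φ ψ) χ) (imp (imp (imp ψ φ) χ) χ))
  | a9 (φ : Formula) : MTLAxiom (imp bot φ)

/-- An axiomatic extension of MTL, given by the set of axioms (read as schemata) added to MTL. -/
structure AxiomaticExtension where
  extraAxioms : Set Formula

/-- `L.Provable φ` is `⊢_L φ`: derivability from the axioms of MTL and the substitution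
instances of the additional axioms by modus ponens. -/
inductive AxiomaticExtension.Provable (L : AxiomaticExtension) : Formula → Prop
  | mtl {φ : Formula} : MTLAxiom φ → L.Provable φ
  | extra {φ : Formula} (σ : ℕ → Formula) : φ ∈ L.extraAxioms → L.Provable (φ.subst σ)
  | mp {φ ψ : Formula} : L.Provable φ → L.Provable (Formula.imp φ ψ) → L.Provable ψ

/-- FL_ew-algebras: bounded commutative integral residuated lattices. -/
class FLewAlgebra (A : Type u) extends Lattice A, BoundedOrder A, CommMonoid A where
  /-- the residuum `x ⇒ y` -/
  res : A → A → A
  one_eq_top : (1 : A) = ⊤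
  mul_le_iff_le_res : ∀ x y z : A, z * x ≤ y ↔ z ≤ res x y

/-- MTL-algebras: prelinear FL_ew-algebras. -/
class MTLAlgebra (A : Type u) extends FLewAlgebra A where
  prelinearity : ∀ x y : A, res x y ⊔ res y x = 1

/-- The value of a formula under an assignment. -/
def Formula.eval {A : Type u} [MTLAlgebra A] (v : ℕ → A) : Formula → A
  | .var i => v i
  | .bot => ⊥
  | .conj φ ψ => φ.eval v * ψ.eval v
  | .meet φ ψ => φ.eval v ⊓ ψ.eval v
  | .imp φ ψ => FLewAlgebra.res (φ.eval v) (ψ.eval v)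

/-- `φ` is valid in `A`: it takes the value `1` under every assignment. -/
def Valid (A : Type u) [MTLAlgebra A] (φ : Formula) : Prop :=
  ∀ v : ℕ → A, φ.eval v = 1

/-- The identity `s ≈ t` holds in `A`. Every term in the operations `*, ⇒, ⊓, ⊔, 0, 1` of
MTL-algebras is equivalent to a formula, since `1 = 0 ⇒ 0` and
`x ⊔ y = ((x ⇒ y) ⇒ y) ⊓ ((y ⇒ x) ⇒ x)`. -/
def SatisfiesIdentity (A : Type u) [MTLAlgebra A] (s t : Formula) : Prop :=
  ∀ v : ℕ → A, s.eval v = t.eval v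

/-- `A` is totally ordered. -/
def IsMTLChain (A : Type u) [MTLAlgebra A] : Prop :=
  ∀ x y : A, x ≤ y ∨ y ≤ x

/-- The equivalence relation `θ` is a congruence of the algebra `A`. -/
structure IsCongruence {A : Type u} [MTLAlgebra A] (θ : Setoid A) : Prop where
  mul : ∀ {a a' b b' : A}, θ a a' → θ b b' → θ (a * b) (a' * b')
  res : ∀ {a a' b b' : A}, θ a a' → θ b b' →
    θ (FLewAlgebra.res a b) (FLewAlgebra.res a' b')
  inf : ∀ {a a' b b' : A}, θ a a' → θ b b' → θ (a ⊓ b) (a' ⊓ b')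
  sup : ∀ {a a' b b' : A}, θ a a' → θ b b' → θ (a ⊔ b) (a' ⊔ b')

/-- `A` is subdirectly irreducible: it is trivial, or there is a least congruence among those
different from equality. -/
def IsSubdirectlyIrreducible (A : Type u) [MTLAlgebra A] : Prop :=
  Subsingleton A ∨
    ∃ μ : Setoid A, IsCongruence μ ∧ μ ≠ ⊥ ∧
      ∀ θ : Setoid A, IsCongruence θ → θ ≠ ⊥ → μ ≤ θ

/-- Membership in the subalgebra of `A` generated by `S`. -/
inductive MemGenerated {A : Type u} [MTLAlgebra A] (S : Set A) : A → Prop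
  | base {a : A} : a ∈ S → MemGenerated S a
  | zero : MemGenerated S ⊥
  | one : MemGenerated S 1
  | mul {a b : A} : MemGenerated S a → MemGenerated S b → MemGenerated S (a * b)
  | res {a b : A} : MemGenerated S a → MemGenerated S b →
      MemGenerated S (FLewAlgebra.res a b)
  | inf {a b : A} : MemGenerated S a → MemGenerated S b → MemGenerated S (a ⊓ b)
  | sup {a b : A} : MemGenerated S a → MemGenerated S b → MemGenerated S (a ⊔ b)

namespace AxiomaticExtension

/-- `A` is an L-algebra, that is, it belongs to the variety corresponding to `L`. -/
def IsAlgebra (L : AxiomaticExtension) (A : Type u) [MTLAlgebra A] : Prop :=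
  ∀ φ ∈ L.extraAxioms, Valid A φ

/-- `L` is complete with respect to the algebra `A`. -/
def IsCompleteWrt (L : AxiomaticExtension) (A : Type u) [MTLAlgebra A] : Prop :=
  ∀ φ : Formula, L.Provable φ ↔ Valid A φ

/-- `A` is a generic L-algebra: it is an L-algebra that generates the variety of L-algebras, i.e.
every identity that holds in `A` holds in all L-algebras. -/
def IsGeneric (L : AxiomaticExtension) (A : Type u) [MTLAlgebra A] : Prop :=
  L.IsAlgebra A ∧ ∀ s t : Formula, SatisfiesIdentity A s t →
    ∀ (B : Type u) [MTLAlgebra B], L.IsAlgebra B → SatisfiesIdentity B s t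

/-- Single chain completeness. -/
def SCC (L : AxiomaticExtension) : Prop :=
  ∃ (A : Type u) (_ : MTLAlgebra A), L.IsAlgebra A ∧ IsMTLChain A ∧ L.IsCompleteWrt A

/-- Subdirect single chain completeness. -/
def SubSCC (L : AxiomaticExtension) : Prop :=
  ∃ (A : Type u) (_ : MTLAlgebra A), IsSubdirectlyIrreducible A ∧ L.IsGeneric A

/-- The variety of L-algebras is locally finite: finitely generated subalgebras of L-algebras
are finite. -/
def LocallyFiniteVariety (L : AxiomaticExtension) : Prop :=
  ∀ (A : Type u) [MTLAlgebra A], L.IsAlgebra A →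
    ∀ S : Set A, S.Finite → {a : A | MemGenerated S a}.Finite

/-- `L` is `n`-contractive: `⊢_L φⁿ → φⁿ⁺¹` for all `φ`. -/
def IsContractive (L : AxiomaticExtension) (n : ℕ) : Prop :=
  ∀ φ : Formula, L.Provable (Formula.imp (φ.pow n) (φ.pow (n + 1)))

end AxiomaticExtension

end MTL

/-!
By the Lindenbaum algebra, an `L`-algebra is generic iff `L` is complete with respect to it. So both
the SCC and the subSCC ask for an `L`-algebra whose valid formulas are the theorems of `L`: a chain
for the SCC, a subdirectly irreducible algebra for the subSCC. Congruences correspond to filters,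
and a nontrivial `A` is subdirectly irreducible iff some `c ≠ 1` lies in every nontrivial filter. If
so, `A` is a chain: if `x ⇒ y` and `y ⇒ x` were both different from `1`, then `c` would lie above
powers of both, and the join of these powers is `1` by prelinearity.

Conversely, let `A` be a nontrivial chain and `I = A \ {1}`. In the power `A ^ I`, take the filter
of the families that are eventually `1` as the index increases, and extend it to a filter `F`
maximal among those avoiding the identity family `b = (i)ᵢ`. Then `A ^ I / F` is subdirectly
irreducible. As `b` eventually exceeds every constant `a ≠ 1`, no such constant is in `F`, so `A`
embeds in this quotient, which therefore validates the same formulas as `A`.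

Contractivity: in the power `A ^ A` of an `L`-algebra `A` with respect to which `L` is complete, the
powers of the identity map form a finite decreasing sequence, so that `aⁿ ≤ aⁿ⁺¹` holds in `A` for
some `n` that does not depend on `a`.
-/

namespace MTL

local notation:60 x:61 " ⇒ " y:60 => FLewAlgebra.res x y

section Residuation

namespace FLewAlgebra

variable {A : Type*} [FLewAlgebra A] {x x' y y' z : A}

theorem le_one (x : A) : x ≤ 1 := one_eq_top (A := A) ▸ le_top

theorem gc_mul_res (x : A) : GaloisConnection (· * x) (x ⇒ ·) := fun z y ↦
  mul_le_iff_le_res x y z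

instance : IsOrderedMonoid A where
  mul_le_mul_left _ _ h z := (gc_mul_res z).monotone_l h

theorem res_eq_one_iff : x ⇒ y = 1 ↔ x ≤ y := by
  rw [← one_mul x, mul_le_iff_le_res, one_mul, (le_one _).ge_iff_eq]

theorem one_res (x : A) : 1 ⇒ x = x :=
  eq_of_forall_le_iff fun z ↦ by rw [← mul_le_iff_le_res, mul_one]

theorem mul_le_left (x y : A) : x * y ≤ x := mul_le_of_le_one_right' (le_one y)

theorem mul_le_right (x y : A) : x * y ≤ y := mul_le_of_le_one_left' (le_one x)

theorem mul_le_inf (x y : A) : x * y ≤ x ⊓ y := le_inf (mul_le_left x y) (mul_le_right x y)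

theorem res_mul_le (x y : A) : (x ⇒ y) * x ≤ y := (gc_mul_res x).l_u_le y

theorem mul_res_le (x y : A) : x * (x ⇒ y) ≤ y := mul_comm x _ ▸ res_mul_le x y

theorem res_anti_left (h : x ≤ x') (y : A) : x' ⇒ y ≤ x ⇒ y :=
  (mul_le_iff_le_res _ _ _).1 ((mul_le_mul_right h _).trans (res_mul_le x' y))

theorem res_mono_right (x : A) (h : y ≤ y') : x ⇒ y ≤ x ⇒ y' := (gc_mul_res x).monotone_u h

theorem mul_res (x y z : A) : x * y ⇒ z = x ⇒ y ⇒ z :=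
  eq_of_forall_le_iff fun w ↦ by
    rw [← mul_le_iff_le_res, ← mul_le_iff_le_res, ← mul_le_iff_le_res, mul_assoc]

protected theorem sup_mul (x y z : A) : (x ⊔ y) * z = x * z ⊔ y * z := (gc_mul_res z).l_sup

theorem res_inf (x y z : A) : x ⇒ y ⊓ z = (x ⇒ y) ⊓ (x ⇒ z) := (gc_mul_res x).u_inf

theorem sup_res (x y z : A) : x ⊔ y ⇒ z = (x ⇒ z) ⊓ (y ⇒ z) :=
  eq_of_forall_le_iff fun w ↦ by
    simp only [le_inf_iff, ← mul_le_iff_le_res, mul_comm w, FLewAlgebra.sup_mul, sup_le_iff]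

theorem res_mul_res_le_res (x y z : A) : (x ⇒ y) * (y ⇒ z) ≤ x ⇒ z := by
  rw [← mul_le_iff_le_res, mul_right_comm]
  exact (mul_le_mul_left (res_mul_le x y) _).trans (mul_res_le y z)

theorem res_mul_res_le_mul_res_mul (x x' y y' : A) :
    (x ⇒ x') * (y ⇒ y') ≤ x * y ⇒ x' * y' := by
  rw [← mul_le_iff_le_res, mul_mul_mul_comm]
  exact mul_le_mul' (res_mul_le x x') (res_mul_le y y')

theorem res_mul_res_le_res_res_res (x x' y y' : A) :
    (x' ⇒ x) * (y ⇒ y') ≤ (x ⇒ y) ⇒ (x' ⇒ y') := by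
  rw [← mul_le_iff_le_res, mul_right_comm]
  exact (mul_le_mul_left (res_mul_res_le_res x' x y) _).trans (res_mul_res_le_res x' y y')

theorem res_inf_res_le_inf_res_inf (x x' y y' : A) :
    (x ⇒ x') ⊓ (y ⇒ y') ≤ x ⊓ y ⇒ x' ⊓ y' := by
  rw [res_inf]
  exact inf_le_inf (res_anti_left inf_le_left _) (res_anti_left inf_le_right _)

theorem res_inf_res_le_sup_res_sup (x x' y y' : A) :
    (x ⇒ x') ⊓ (y ⇒ y') ≤ x ⊔ y ⇒ x' ⊔ y' := by
  rw [sup_res]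
  exact inf_le_inf (res_mono_right _ le_sup_left) (res_mono_right _ le_sup_right)

theorem sup_mul_eq_one (hy : x ⊔ y = 1) (hz : x ⊔ z = 1) : x ⊔ y * z = 1 :=
  le_antisymm (le_one _) <| calc
    1 = x * (x ⊔ z) ⊔ y * (x ⊔ z) := by rw [← FLewAlgebra.sup_mul, hy, hz, one_mul]
    _ = x * (x ⊔ z) ⊔ (x * y ⊔ z * y) := by rw [mul_comm y, FLewAlgebra.sup_mul]
    _ ≤ x ⊔ y * z := sup_le (le_sup_of_le_left (mul_le_left _ _))
      (sup_le_sup (mul_le_left _ _) (mul_comm z y).le)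

theorem sup_pow_eq_one (h : x ⊔ y = 1) (n : ℕ) : x ⊔ y ^ n = 1 := by
  induction n with
  | zero => rw [pow_zero, sup_eq_right.2 (le_one x)]
  | succ n ih => rw [pow_succ, sup_mul_eq_one ih h]

theorem pow_sup_pow_eq_one (h : x ⊔ y = 1) (m n : ℕ) : x ^ m ⊔ y ^ n = 1 := by
  rw [sup_comm]
  exact sup_pow_eq_one (sup_comm x _ ▸ sup_pow_eq_one h n) m

end FLewAlgebra

theorem exists_pow_le_pow_succ {M : Type*} [CommMonoid M] [PartialOrder M] [IsOrderedMonoid M]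
    {a : M} (ha : a ≤ 1) (hfin : (Submonoid.powers a : Set M).Finite) :
    ∃ n : ℕ, 0 < n ∧ a ^ n ≤ a ^ (n + 1) := by
  obtain ⟨m, k, hmk, hpow⟩ :=
    hfin.exists_lt_map_eq_of_forall_mem (f := fun n : ℕ ↦ a ^ n) fun n ↦
      pow_mem (Submonoid.mem_powers a) n
  refine ⟨m + 1, m.succ_pos, ?_⟩
  calc a ^ (m + 1) = a ^ (k + 1) := by rw [pow_succ, pow_succ, hpow]
    _ ≤ a ^ (m + 1 + 1) := pow_le_pow_right_of_le_one' ha (by lia)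

end Residuation

open FLewAlgebra

section Semantics

variable {A : Type*} [MTLAlgebra A] {φ : Formula}

theorem Formula.eval_subst (v : ℕ → A) (σ : ℕ → Formula) (φ : Formula) :
    (φ.subst σ).eval v = φ.eval fun i ↦ (σ i).eval v := by
  induction φ <;> simp_all only [Formula.subst, Formula.eval]

theorem Formula.eval_pow (v : ℕ → A) (φ : Formula) : ∀ n : ℕ, (φ.pow n).eval v = φ.eval v ^ n
  | 0 => res_eq_one_iff.2 le_rfl |>.trans (pow_zero _).symm
  | 1 => (pow_one _).symm
  | n + 2 => by rw [Formula.pow, Formula.eval, Formula.eval_pow v φ (n + 1), pow_succ _ (n + 1)]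

theorem valid_imp_iff {ψ : Formula} :
    Valid A (.imp φ ψ) ↔ ∀ v : ℕ → A, φ.eval v ≤ ψ.eval v :=
  forall_congr' fun _ ↦ res_eq_one_iff

theorem valid_iff_satisfiesIdentity : Valid A φ ↔ SatisfiesIdentity A φ (.imp .bot .bot) :=
  forall_congr' fun _ ↦ by rw [Formula.eval, res_eq_one_iff.2 le_rfl]

theorem res_res_le_res_res_of_prelinearity (x y z : A) :
    (x ⇒ y) ⇒ z ≤ ((y ⇒ x) ⇒ z) ⇒ z := by
  rw [← mul_le_iff_le_res, ← one_mul (((x ⇒ y) ⇒ z) * _),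
    ← MTLAlgebra.prelinearity x y, FLewAlgebra.sup_mul]
  refine sup_le ?_ ?_
  · exact (mul_le_mul_right (mul_le_left _ _) _).trans (mul_res_le _ _)
  · exact (mul_le_mul_right (mul_le_right _ _) _).trans (mul_res_le _ _)

theorem MTLAxiom.valid (h : MTLAxiom φ) : Valid A φ := by
  cases h <;> refine valid_imp_iff.2 fun v ↦ ?_ <;> simp only [Formula.eval]
  case a1 => exact (mul_le_iff_le_res _ _ _).1 (res_mul_res_le_res _ _ _)
  case a2 => exact mul_le_left _ _
  case a3 => exact (mul_comm _ _).le
  case a4 => exact inf_le_left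
  case a5 => exact (inf_comm _ _).le
  case a6 => exact le_inf (mul_res_le _ _) (mul_le_left _ _)
  case a7a => exact (mul_res _ _ _).ge
  case a7b => exact (mul_res _ _ _).le
  case a8 => exact res_res_le_res_res_of_prelinearity _ _ _
  case a9 => exact bot_le

theorem AxiomaticExtension.Provable.valid {L : AxiomaticExtension} (hA : L.IsAlgebra A)
    (h : L.Provable φ) : Valid A φ := by
  induction h with
  | mtl h => exact h.valid
  | extra σ h => exact fun v ↦ (Formula.eval_subst v σ _).trans (hA _ h _)
  | mp _ _ ihφ ihimp =>
    exact fun v ↦ le_antisymm (le_one _) ((ihφ v).ge.trans (valid_imp_iff.1 ihimp v))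

end Semantics

section Homomorphisms

variable {A B C : Type*} [MTLAlgebra A] [MTLAlgebra B] [MTLAlgebra C] {f : A → B} {φ : Formula}

/-- Homomorphisms of MTL-algebras. Only the operations that interpret the connectives are
mentioned, since `1` and `⊔` are definable from them. -/
structure IsMTLHom (f : A → B) : Prop where
  map_bot : f ⊥ = ⊥
  map_mul : ∀ x y, f (x * y) = f x * f y
  map_inf : ∀ x y, f (x ⊓ y) = f x ⊓ f y
  map_res : ∀ x y, f (x ⇒ y) = f x ⇒ f y

namespace IsMTLHom

theorem map_one (hf : IsMTLHom f) : f 1 = 1 := by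
  rw [← res_eq_one_iff.2 (le_refl (⊥ : A)), hf.map_res, res_eq_one_iff.2 le_rfl]

theorem comp {g : B → C} (hg : IsMTLHom g) (hf : IsMTLHom f) : IsMTLHom (g ∘ f) where
  map_bot := by simp only [Function.comp_apply, hf.map_bot, hg.map_bot]
  map_mul _ _ := by simp only [Function.comp_apply, hf.map_mul, hg.map_mul]
  map_inf _ _ := by simp only [Function.comp_apply, hf.map_inf, hg.map_inf]
  map_res _ _ := by simp only [Function.comp_apply, hf.map_res, hg.map_res]

theorem eval_comp (hf : IsMTLHom f) (v : ℕ → A) (φ : Formula) :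
    φ.eval (f ∘ v) = f (φ.eval v) := by
  induction φ with
  | var i => rfl
  | bot => exact hf.map_bot.symm
  | conj φ ψ ihφ ihψ => simp only [Formula.eval, ihφ, ihψ, hf.map_mul]
  | meet φ ψ ihφ ihψ => simp only [Formula.eval, ihφ, ihψ, hf.map_inf]
  | imp φ ψ ihφ ihψ => simp only [Formula.eval, ihφ, ihψ, hf.map_res]

theorem valid_of_surjective (hf : IsMTLHom f) (hsurj : Function.Surjective f) (h : Valid A φ) :
    Valid B φ := by
  intro v
  obtain ⟨w, rfl⟩ := hsurj.comp_left v
  rw [hf.eval_comp, h, hf.map_one]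

theorem valid_of_forall_eq_one (hf : IsMTLHom f) (hker : ∀ a, f a = 1 → a = 1)
    (h : Valid B φ) : Valid A φ := fun v ↦
  hker _ <| by rw [← hf.eval_comp, h]

end IsMTLHom

end Homomorphisms

section Products

variable {I : Type*} {A : I → Type*} {B : Type*} [∀ i, MTLAlgebra (A i)] [MTLAlgebra B]
  {φ : Formula}

instance {A : I → Type*} [∀ i, FLewAlgebra (A i)] : FLewAlgebra (∀ i, A i) where
  res f g i := f i ⇒ g i
  one_eq_top := funext fun _ ↦ one_eq_top
  mul_le_iff_le_res f g h := forall_congr' fun i ↦ mul_le_iff_le_res (f i) (g i) (h i)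

instance : MTLAlgebra (∀ i, A i) where
  prelinearity f g := funext fun i ↦ MTLAlgebra.prelinearity (f i) (g i)

theorem isMTLHom_apply (i : I) : IsMTLHom fun f : ∀ i, A i ↦ f i :=
  ⟨rfl, fun _ _ ↦ rfl, fun _ _ ↦ rfl, fun _ _ ↦ rfl⟩

theorem isMTLHom_const : IsMTLHom (Function.const I : B → I → B) :=
  ⟨rfl, fun _ _ ↦ rfl, fun _ _ ↦ rfl, fun _ _ ↦ rfl⟩

theorem valid_pi (h : ∀ i, Valid (A i) φ) : Valid (∀ i, A i) φ := fun v ↦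
  funext fun i ↦ ((isMTLHom_apply i).eval_comp v φ).symm.trans (h i _)

instance : MTLAlgebra (ULift B) where
  res x y := ⟨x.down ⇒ y.down⟩
  one_eq_top := congrArg ULift.up one_eq_top
  mul_le_iff_le_res x y z := mul_le_iff_le_res x.down y.down z.down
  prelinearity x y := congrArg ULift.up (MTLAlgebra.prelinearity x.down y.down)

theorem valid_ulift_iff : Valid (ULift B) φ ↔ Valid B φ := by
  have hdown : IsMTLHom (ULift.down : ULift B → B) :=
    ⟨rfl, fun _ _ ↦ rfl, fun _ _ ↦ rfl, fun _ _ ↦ rfl⟩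
  exact ⟨hdown.valid_of_surjective ULift.down_surjective,
    hdown.valid_of_forall_eq_one fun _ h ↦ ULift.down_injective h⟩

end Products

section Lindenbaum

open Formula

/-- The disjunction of MTL, a derived connective that denotes the join in every MTL-algebra. -/
def Formula.join (φ ψ : Formula) : Formula :=
  meet (imp (imp φ ψ) ψ) (imp (imp ψ φ) φ)

theorem Formula.subst_var (φ : Formula) : φ.subst var = φ := by
  induction φ <;> simp_all only [Formula.subst]

namespace AxiomaticExtension

variable {L : AxiomaticExtension} {φ φ' ψ ψ' χ : Formula}

namespace Provable

theorem imp_trans (h : L.Provable (imp φ ψ)) (h' : L.Provable (imp ψ χ)) :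
    L.Provable (imp φ χ) :=
  .mp h' (.mp h (.mtl (.a1 _ _ _)))

theorem conj_imp_iff : L.Provable (imp (conj φ ψ) χ) ↔ L.Provable (imp φ (imp ψ χ)) :=
  ⟨fun h ↦ .mp h (.mtl (.a7b _ _ _)), fun h ↦ .mp h (.mtl (.a7a _ _ _))⟩

theorem imp_imp_self (φ ψ : Formula) : L.Provable (imp φ (imp ψ φ)) :=
  conj_imp_iff.1 (.mtl (.a2 _ _))

theorem imp_swap (h : L.Provable (imp φ (imp ψ χ))) : L.Provable (imp ψ (imp φ χ)) :=
  conj_imp_iff.1 (imp_trans (.mtl (.a3 _ _)) (conj_imp_iff.2 h))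

theorem imp_refl (φ : Formula) : L.Provable (imp φ φ) :=
  .mp (.mtl (.a9 bot)) (imp_swap (imp_imp_self φ (imp bot bot)))

theorem imp_detach (φ ψ : Formula) : L.Provable (imp φ (imp (imp φ ψ) ψ)) :=
  imp_swap (imp_refl _)

theorem imp_true_iff : L.Provable (imp (imp bot bot) φ) ↔ L.Provable φ :=
  ⟨fun h ↦ .mp (imp_refl _) h, fun h ↦ .mp h (imp_imp_self _ _)⟩

theorem imp_mono (h : L.Provable (imp φ' φ)) (h' : L.Provable (imp ψ ψ')) :
    L.Provable (imp (imp φ ψ) (imp φ' ψ')) :=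
  imp_trans (.mp h (.mtl (.a1 _ _ _))) (.mp h' (imp_swap (.mtl (.a1 _ _ _))))

theorem conj_mono (h : L.Provable (imp φ φ')) (h' : L.Provable (imp ψ ψ')) :
    L.Provable (imp (conj φ ψ) (conj φ' ψ')) :=
  conj_imp_iff.2 (imp_trans h
    (imp_trans (conj_imp_iff.1 (imp_refl _)) (imp_mono h' (imp_refl _))))

theorem conj_assoc (φ ψ χ : Formula) :
    L.Provable (imp (conj (conj φ ψ) χ) (conj φ (conj ψ χ))) :=
  conj_imp_iff.2 (conj_imp_iff.2
    (imp_trans (conj_imp_iff.1 (imp_refl _)) (.mtl (.a7b _ _ _))))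

theorem conj_assoc_symm (φ ψ χ : Formula) :
    L.Provable (imp (conj φ (conj ψ χ)) (conj (conj φ ψ) χ)) :=
  conj_imp_iff.2
    (imp_trans (conj_imp_iff.1 (conj_imp_iff.1 (imp_refl _))) (.mtl (.a7a _ _ _)))

theorem meet_imp_left (φ ψ : Formula) : L.Provable (imp (meet φ ψ) φ) := .mtl (.a4 _ _)

theorem meet_imp_right (φ ψ : Formula) : L.Provable (imp (meet φ ψ) ψ) :=
  imp_trans (.mtl (.a5 _ _)) (.mtl (.a4 _ _))

theorem of_imp_of_imp (φ ψ : Formula) (h : L.Provable (imp (imp φ ψ) χ))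
    (h' : L.Provable (imp (imp ψ φ) χ)) : L.Provable χ :=
  .mp h' (.mp h (.mtl (.a8 _ _ _)))

/-- Divisibility only turns `φ & (φ → ψ)` into `φ ∧ ψ`, hence the case distinction by
prelinearity. -/
theorem imp_meet (h : L.Provable (imp χ φ)) (h' : L.Provable (imp χ ψ)) :
    L.Provable (imp χ (meet φ ψ)) := by
  refine of_imp_of_imp φ ψ ?_ ?_
  · have hmeet : L.Provable (imp (conj φ (imp φ ψ)) (meet φ ψ)) :=
      imp_trans (.mtl (.a6 _ _)) (.mtl (.a5 _ _))
    exact imp_swap (imp_trans h (conj_imp_iff.1 hmeet))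
  · have hmeet : L.Provable (imp (conj ψ (imp ψ φ)) (meet φ ψ)) := .mtl (.a6 _ _)
    exact imp_swap (imp_trans h' (conj_imp_iff.1 hmeet))

theorem meet_mono (h : L.Provable (imp φ φ')) (h' : L.Provable (imp ψ ψ')) :
    L.Provable (imp (meet φ ψ) (meet φ' ψ')) :=
  imp_meet (imp_trans (meet_imp_left _ _) h) (imp_trans (meet_imp_right _ _) h')

theorem imp_join_left (φ ψ : Formula) : L.Provable (imp φ (join φ ψ)) :=
  imp_meet (imp_detach _ _) (imp_imp_self _ _)

theorem imp_join_right (φ ψ : Formula) : L.Provable (imp ψ (join φ ψ)) :=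
  imp_meet (imp_imp_self _ _) (imp_detach _ _)

theorem join_imp (h : L.Provable (imp φ χ)) (h' : L.Provable (imp ψ χ)) :
    L.Provable (imp (join φ ψ) χ) :=
  of_imp_of_imp φ ψ
    (imp_swap (imp_trans (meet_imp_left _ _) (imp_mono (imp_refl _) h')))
    (imp_swap (imp_trans (meet_imp_right _ _) (imp_mono (imp_refl _) h)))

theorem join_mono (h : L.Provable (imp φ φ')) (h' : L.Provable (imp ψ ψ')) :
    L.Provable (imp (join φ ψ) (join φ' ψ')) :=
  join_imp (imp_trans h (imp_join_left _ _)) (imp_trans h' (imp_join_right _ _))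

theorem prelinearity (φ ψ : Formula) : L.Provable (join (imp φ ψ) (imp ψ φ)) :=
  of_imp_of_imp φ ψ (imp_join_left _ _) (imp_join_right _ _)

end Provable

open Provable

variable (L)

/-- Formulas preordered by provable implication in `L`. -/
abbrev provablePreorder : Preorder Formula where
  le φ ψ := L.Provable (imp φ ψ)
  le_refl := imp_refl
  le_trans _ _ _ := imp_trans

/-- Provable equivalence of formulas in `L`. -/
def provableSetoid : Setoid Formula :=
  letI := L.provablePreorder
  AntisymmRel.setoid Formula (· ≤ ·)

/-- The Lindenbaum algebra of `L`: formulas modulo provable equivalence. -/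
def Lindenbaum : Type := Quotient L.provableSetoid

/-- The class of a formula in the Lindenbaum algebra. -/
def toLindenbaum (φ : Formula) : L.Lindenbaum := Quotient.mk L.provableSetoid φ

instance : PartialOrder L.Lindenbaum :=
  @instPartialOrderAntisymmetrization Formula L.provablePreorder

variable {L} in
theorem toLindenbaum_eq (h : L.Provable (imp φ ψ)) (h' : L.Provable (imp ψ φ)) :
    L.toLindenbaum φ = L.toLindenbaum ψ :=
  Quotient.sound (s := L.provableSetoid) ⟨h, h'⟩

instance : Lattice L.Lindenbaum where
  inf := Quotient.map₂ meet fun _ _ h _ _ h' ↦ ⟨meet_mono h.1 h'.1, meet_mono h.2 h'.2⟩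
  sup := Quotient.map₂ join fun _ _ h _ _ h' ↦ ⟨join_mono h.1 h'.1, join_mono h.2 h'.2⟩
  inf_le_left := by rintro ⟨φ⟩ ⟨ψ⟩; exact meet_imp_left φ ψ
  inf_le_right := by rintro ⟨φ⟩ ⟨ψ⟩; exact meet_imp_right φ ψ
  le_inf := by rintro ⟨φ⟩ ⟨ψ⟩ ⟨χ⟩; exact imp_meet
  le_sup_left := by rintro ⟨φ⟩ ⟨ψ⟩; exact imp_join_left φ ψ
  le_sup_right := by rintro ⟨φ⟩ ⟨ψ⟩; exact imp_join_right φ ψ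
  sup_le := by rintro ⟨φ⟩ ⟨ψ⟩ ⟨χ⟩; exact join_imp

instance : BoundedOrder L.Lindenbaum where
  top := L.toLindenbaum (imp bot bot)
  le_top := by rintro ⟨φ⟩; exact .mp (imp_refl bot) (imp_imp_self _ φ)
  bot := L.toLindenbaum bot
  bot_le := by rintro ⟨φ⟩; exact .mtl (.a9 φ)

instance : CommMonoid L.Lindenbaum where
  one := L.toLindenbaum (imp bot bot)
  mul := Quotient.map₂ conj fun _ _ h _ _ h' ↦ ⟨conj_mono h.1 h'.1, conj_mono h.2 h'.2⟩
  mul_assoc := by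
    rintro ⟨φ⟩ ⟨ψ⟩ ⟨χ⟩
    exact toLindenbaum_eq (conj_assoc φ ψ χ) (conj_assoc_symm φ ψ χ)
  mul_comm := by rintro ⟨φ⟩ ⟨ψ⟩; exact toLindenbaum_eq (.mtl (.a3 φ ψ)) (.mtl (.a3 ψ φ))
  one_mul := by
    rintro ⟨φ⟩
    exact toLindenbaum_eq (imp_trans (.mtl (.a3 _ _)) (.mtl (.a2 _ _)))
      (imp_true_iff.1 (conj_imp_iff.1 (imp_refl _)))
  mul_one := by
    rintro ⟨φ⟩
    exact toLindenbaum_eq (.mtl (.a2 _ _))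
      (imp_true_iff.1 (imp_swap (conj_imp_iff.1 (imp_refl _))))

instance : MTLAlgebra L.Lindenbaum where
  res := Quotient.map₂ imp fun _ _ h _ _ h' ↦ ⟨imp_mono h.2 h'.1, imp_mono h.1 h'.2⟩
  one_eq_top := rfl
  mul_le_iff_le_res := by rintro ⟨φ⟩ ⟨ψ⟩ ⟨χ⟩; exact conj_imp_iff
  prelinearity := by
    rintro ⟨φ⟩ ⟨ψ⟩
    exact le_antisymm (le_top (α := L.Lindenbaum)) (imp_true_iff.2 (Provable.prelinearity φ ψ))

theorem eval_toLindenbaum (σ : ℕ → Formula) (φ : Formula) :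
    φ.eval (fun i ↦ L.toLindenbaum (σ i)) = L.toLindenbaum (φ.subst σ) := by
  induction φ with
  | var i => rfl
  | bot => rfl
  | conj φ ψ ihφ ihψ => rw [Formula.eval, ihφ, ihψ]; rfl
  | meet φ ψ ihφ ihψ => rw [Formula.eval, ihφ, ihψ]; rfl
  | imp φ ψ ihφ ihψ => rw [Formula.eval, ihφ, ihψ]; rfl

variable {L} in
theorem toLindenbaum_eq_one_iff : L.toLindenbaum φ = 1 ↔ L.Provable φ := by
  rw [← (le_one _).ge_iff_eq]
  exact imp_true_iff

theorem isAlgebra_lindenbaum : L.IsAlgebra L.Lindenbaum := by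
  intro φ hφ v
  obtain ⟨σ, rfl⟩ := (Quotient.mk_surjective (s := L.provableSetoid)).comp_left v
  exact (L.eval_toLindenbaum σ φ).trans (toLindenbaum_eq_one_iff.2 (.extra σ hφ))

theorem isCompleteWrt_lindenbaum : L.IsCompleteWrt L.Lindenbaum := fun φ ↦
  ⟨fun h ↦ h.valid L.isAlgebra_lindenbaum, fun h ↦ by
    rw [← toLindenbaum_eq_one_iff, ← φ.subst_var, ← L.eval_toLindenbaum]
    exact h _⟩

theorem exists_isAlgebra_isCompleteWrt :
    ∃ (A : Type u) (_ : MTLAlgebra A), L.IsAlgebra A ∧ L.IsCompleteWrt A :=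
  ⟨ULift L.Lindenbaum, inferInstance,
    fun φ hφ ↦ valid_ulift_iff.2 (L.isAlgebra_lindenbaum φ hφ),
    fun φ ↦ (L.isCompleteWrt_lindenbaum φ).trans valid_ulift_iff.symm⟩

variable {L}

theorem isGeneric_iff {A : Type u} [MTLAlgebra A] :
    L.IsGeneric A ↔ L.IsAlgebra A ∧ L.IsCompleteWrt A := by
  refine and_congr_right fun hA ↦ ⟨fun hgen φ ↦ ⟨fun h ↦ h.valid hA, fun h ↦ ?_⟩, ?_⟩
  · obtain ⟨B, _, hB, hcomp⟩ := L.exists_isAlgebra_isCompleteWrt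
    rw [hcomp, valid_iff_satisfiesIdentity]
    exact hgen _ _ (valid_iff_satisfiesIdentity.1 h) B hB
  · intro hcomp s t hst B _ hB v
    have hle : L.Provable (imp s t) := (hcomp _).2 (valid_imp_iff.2 fun v ↦ (hst v).le)
    have hge : L.Provable (imp t s) := (hcomp _).2 (valid_imp_iff.2 fun v ↦ (hst v).ge)
    exact le_antisymm (valid_imp_iff.1 (hle.valid hB) v) (valid_imp_iff.1 (hge.valid hB) v)

end AxiomaticExtension

end Lindenbaum

section Contractivity

variable {L : AxiomaticExtension}

theorem AxiomaticExtension.IsCompleteWrt.isContractive {A : Type*} [MTLAlgebra A]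
    (hA : L.IsCompleteWrt A) {n : ℕ} (h : ∀ a : A, a ^ n ≤ a ^ (n + 1)) : L.IsContractive n :=
  fun φ ↦ (hA _).2 <| valid_imp_iff.2 fun v ↦ by simpa only [Formula.eval_pow] using h (φ.eval v)

theorem AxiomaticExtension.exists_isContractive
    (hfin : ∀ (A : Type u) [MTLAlgebra A], L.IsAlgebra A →
      ∀ a : A, (Submonoid.powers a : Set A).Finite) :
    ∃ n : ℕ, 0 < n ∧ L.IsContractive n := by
  obtain ⟨A, _, hA, hcomp⟩ := L.exists_isAlgebra_isCompleteWrt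
  have hpow : L.IsAlgebra (A → A) := fun φ hφ ↦ valid_pi fun _ ↦ hA φ hφ
  obtain ⟨n, hn, hle⟩ := exists_pow_le_pow_succ (le_one _) (hfin (A → A) hpow id)
  exact ⟨n, hn, hcomp.isContractive hle⟩

theorem MemGenerated.of_mem_powers {A : Type*} [MTLAlgebra A] {a b : A}
    (h : b ∈ Submonoid.powers a) : MemGenerated {a} b := by
  obtain ⟨n, rfl⟩ := Submonoid.mem_powers_iff _ _ |>.1 h
  induction n with
  | zero => exact pow_zero a ▸ .one
  | succ n ih => exact pow_succ a n ▸ .mul (ih ⟨n, rfl⟩) (.base rfl)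

end Contractivity

section Filters

/-- Filters of an FL_ew-algebra: the submonoids that are up-sets. -/
structure DeductiveFilter (A : Type*) [FLewAlgebra A] extends Submonoid A where
  isUpperSet' : IsUpperSet carrier

namespace DeductiveFilter

variable {A B : Type*} [FLewAlgebra A] [FLewAlgebra B]

instance : SetLike (DeductiveFilter A) A where
  coe F := F.carrier
  coe_injective := by rintro ⟨⟨⟨_, _⟩, _⟩, _⟩ ⟨⟨⟨_, _⟩, _⟩, _⟩ h; congr

instance : PartialOrder (DeductiveFilter A) := .ofSetLike (DeductiveFilter A) A

instance : SubmonoidClass (DeductiveFilter A) A where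
  mul_mem {F} := F.mul_mem'
  one_mem F := F.one_mem'

/-- The inverse image of a filter under a morphism of ordered monoids. -/
def comap (f : A →*o B) (F : DeductiveFilter B) : DeductiveFilter A where
  toSubmonoid := F.toSubmonoid.comap f.toMonoidHom
  isUpperSet' _ _ h hx := F.isUpperSet' (f.monotone' h) hx

/-- The filter generated by the element `c`. -/
def principal (c : A) : DeductiveFilter A where
  carrier := {x | ∃ n : ℕ, c ^ n ≤ x}
  one_mem' := ⟨0, (pow_zero c).le⟩
  mul_mem' := by
    rintro x y ⟨m, hm⟩ ⟨n, hn⟩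
    exact ⟨m + n, pow_add c m n ▸ mul_le_mul' hm hn⟩
  isUpperSet' := fun _ _ h ⟨n, hn⟩ ↦ ⟨n, hn.trans h⟩

theorem mem_principal_self (c : A) : c ∈ principal c := ⟨1, (pow_one c).le⟩

/-- The filter of a product that consists of the families equal to `1` eventually along `l`. -/
def eventuallyOne {I : Type*} (l : Filter I) (A : I → Type*) [∀ i, FLewAlgebra (A i)] :
    DeductiveFilter (∀ i, A i) where
  carrier := {f | ∀ᶠ i in l, f i = 1}
  one_mem' := .of_forall fun _ ↦ rfl
  mul_mem' hf hg := by
    filter_upwards [hf, hg] with i hfi hgi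
    rw [Pi.mul_apply, hfi, hgi, one_mul]
  isUpperSet' _ _ h hf := hf.mono fun i hi ↦ le_antisymm (le_one _) (hi.ge.trans (h i))

variable {F G : DeductiveFilter A} {c x x' y y' z : A}

theorem mem_of_le (h : x ≤ y) (hx : x ∈ F) : y ∈ F := F.isUpperSet' h hx

theorem principal_le (hc : c ∈ F) : principal c ≤ F := fun _ ⟨n, hn⟩ ↦
  mem_of_le hn (pow_mem hc n)

theorem inf_mem (hx : x ∈ F) (hy : y ∈ F) : x ⊓ y ∈ F := mem_of_le (mul_le_inf x y) (mul_mem hx hy)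

theorem res_mem_of_le (h : x ≤ y) : x ⇒ y ∈ F := res_eq_one_iff.2 h ▸ one_mem F

theorem exists_ge_maximal_notMem (hc : c ∉ G) :
    ∃ F, G ≤ F ∧ Maximal (fun F : DeductiveFilter A ↦ c ∉ F) F := by
  refine zorn_le_nonempty₀ {F : DeductiveFilter A | c ∉ F} (fun C hC hchain F₀ hF₀ ↦ ?_) G hc
  let U : DeductiveFilter A :=
    { carrier := {x | ∃ F ∈ C, x ∈ F}
      one_mem' := ⟨F₀, hF₀, one_mem F₀⟩
      mul_mem' := by
        rintro x y ⟨F, hF, hx⟩ ⟨G, hG, hy⟩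
        rcases hchain.total hF hG with hle | hle
        · exact ⟨G, hG, mul_mem (hle hx) hy⟩
        · exact ⟨F, hF, mul_mem hx (hle hy)⟩
      isUpperSet' := fun _ _ h ⟨F, hF, hx⟩ ↦ ⟨F, hF, mem_of_le h hx⟩ }
  exact ⟨U, fun ⟨F, hF, hcF⟩ ↦ hC hF hcF, fun F hF _ hx ↦ ⟨F, hF, hx⟩⟩

variable (F)

/-- The preorder of `A` modulo the filter `F`: `x` is below `y` if `x ⇒ y` belongs to `F`. -/
abbrev preorder : Preorder A where
  le x y := x ⇒ y ∈ F
  lt x y := x ⇒ y ∈ F ∧ y ⇒ x ∉ F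
  lt_iff_le_not_ge _ _ := Iff.rfl
  le_refl _ := res_mem_of_le le_rfl
  le_trans x y z h h' := mem_of_le (res_mul_res_le_res x y z) (mul_mem h h')

/-- The congruence of the filter `F`. -/
def congruence : Setoid A :=
  letI := F.preorder
  AntisymmRel.setoid A (· ≤ ·)

/-- The quotient of `A` by the filter `F`. -/
def Quotient : Type _ := _root_.Quotient F.congruence

instance : PartialOrder F.Quotient := @instPartialOrderAntisymmetrization A F.preorder

variable {F}

theorem congruence_iff : F.congruence x y ↔ x ⇒ y ∈ F ∧ y ⇒ x ∈ F := Iff.rfl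

theorem congruence_one_iff : F.congruence x 1 ↔ x ∈ F := by
  rw [congruence_iff, one_res, and_iff_right (res_mem_of_le (le_one x))]

theorem congruence_mono (h : F ≤ G) : F.congruence ≤ G.congruence := fun _ _ hxy ↦
  ⟨h hxy.1, h hxy.2⟩

theorem congruence_ne_bot (hx : x ∈ F) (hx1 : x ≠ 1) : F.congruence ≠ ⊥ := fun h ↦
  hx1 (h ▸ congruence_one_iff.2 hx : (⊥ : Setoid A) x 1)

theorem exists_ne_one_of_congruence_ne_bot (h : F.congruence ≠ ⊥) : ∃ x ∈ F, x ≠ 1 := by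
  contrapose! h
  exact le_bot_iff.1 fun x y hxy ↦
    le_antisymm (res_eq_one_iff.1 (h _ hxy.1)) (res_eq_one_iff.1 (h _ hxy.2))

theorem congruence_mul (hx : F.congruence x x') (hy : F.congruence y y') :
    F.congruence (x * y) (x' * y') :=
  ⟨mem_of_le (res_mul_res_le_mul_res_mul x x' y y') (mul_mem hx.1 hy.1),
    mem_of_le (res_mul_res_le_mul_res_mul x' x y' y) (mul_mem hx.2 hy.2)⟩

theorem congruence_res (hx : F.congruence x x') (hy : F.congruence y y') :
    F.congruence (x ⇒ y) (x' ⇒ y') :=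
  ⟨mem_of_le (res_mul_res_le_res_res_res x x' y y') (mul_mem hx.2 hy.1),
    mem_of_le (res_mul_res_le_res_res_res x' x y' y) (mul_mem hx.1 hy.2)⟩

theorem congruence_inf (hx : F.congruence x x') (hy : F.congruence y y') :
    F.congruence (x ⊓ y) (x' ⊓ y') :=
  ⟨mem_of_le (res_inf_res_le_inf_res_inf x x' y y') (inf_mem hx.1 hy.1),
    mem_of_le (res_inf_res_le_inf_res_inf x' x y' y) (inf_mem hx.2 hy.2)⟩

theorem congruence_sup (hx : F.congruence x x') (hy : F.congruence y y') :
    F.congruence (x ⊔ y) (x' ⊔ y') :=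
  ⟨mem_of_le (res_inf_res_le_sup_res_sup x x' y y') (inf_mem hx.1 hy.1),
    mem_of_le (res_inf_res_le_sup_res_sup x' x y' y) (inf_mem hx.2 hy.2)⟩

variable (F)

instance : CommMonoid F.Quotient :=
  inferInstanceAs (CommMonoid (Con.Quotient ⟨F.congruence, congruence_mul⟩))

instance : Lattice F.Quotient where
  inf := Quotient.map₂ (· ⊓ ·) fun _ _ hx _ _ hy ↦ congruence_inf hx hy
  sup := Quotient.map₂ (· ⊔ ·) fun _ _ hx _ _ hy ↦ congruence_sup hx hy
  inf_le_left := by rintro ⟨x⟩ ⟨y⟩; exact res_mem_of_le (F := F) inf_le_left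
  inf_le_right := by rintro ⟨x⟩ ⟨y⟩; exact res_mem_of_le (F := F) inf_le_right
  le_inf := by rintro ⟨x⟩ ⟨y⟩ ⟨z⟩ h h'; exact (res_inf x y z ▸ inf_mem h h' : x ⇒ y ⊓ z ∈ F)
  le_sup_left := by rintro ⟨x⟩ ⟨y⟩; exact res_mem_of_le (F := F) le_sup_left
  le_sup_right := by rintro ⟨x⟩ ⟨y⟩; exact res_mem_of_le (F := F) le_sup_right
  sup_le := by rintro ⟨x⟩ ⟨y⟩ ⟨z⟩ h h'; exact (sup_res x y z ▸ inf_mem h h' : x ⊔ y ⇒ z ∈ F)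

instance : BoundedOrder F.Quotient where
  top := Quotient.mk F.congruence ⊤
  le_top := by rintro ⟨x⟩; exact res_mem_of_le (F := F) le_top
  bot := Quotient.mk F.congruence ⊥
  bot_le := by rintro ⟨x⟩; exact res_mem_of_le (F := F) bot_le

instance : FLewAlgebra F.Quotient where
  res := Quotient.map₂ (· ⇒ ·) fun _ _ hx _ _ hy ↦ congruence_res hx hy
  one_eq_top := congrArg (Quotient.mk F.congruence) one_eq_top
  mul_le_iff_le_res := by
    rintro ⟨x⟩ ⟨y⟩ ⟨z⟩
    exact (iff_of_eq (congrArg (· ∈ F) (mul_res z x y)) :)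

/-- The quotient map modulo `F`, as a morphism of ordered monoids. -/
def toQuotient : A →*o F.Quotient where
  toFun := Quotient.mk F.congruence
  map_one' := rfl
  map_mul' _ _ := rfl
  monotone' _ _ h := res_mem_of_le (F := F) h

theorem toQuotient_surjective : Function.Surjective F.toQuotient := _root_.Quotient.mk_surjective

theorem toQuotient_eq_one_iff : F.toQuotient x = 1 ↔ x ∈ F := by
  rw [← congruence_one_iff]
  exact Quotient.eq (r := F.congruence)

end DeductiveFilter

end Filters

section SubdirectIrreducibility

variable {A : Type u} [MTLAlgebra A]

namespace DeductiveFilter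

variable (F : DeductiveFilter A)

theorem isCongruence : IsCongruence F.congruence :=
  ⟨congruence_mul, congruence_res, congruence_inf, congruence_sup⟩

instance : MTLAlgebra F.Quotient where
  prelinearity := by
    rintro ⟨x⟩ ⟨y⟩
    exact congrArg F.toQuotient (MTLAlgebra.prelinearity x y)

theorem isMTLHom_toQuotient : IsMTLHom F.toQuotient :=
  ⟨rfl, fun _ _ ↦ rfl, fun _ _ ↦ rfl, fun _ _ ↦ rfl⟩

end DeductiveFilter

open DeductiveFilter

namespace IsCongruence

variable {θ : Setoid A} {x y : A}

/-- The filter of a congruence: the class of `1`. -/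
def filter (hθ : IsCongruence θ) : DeductiveFilter A where
  carrier := {x | θ x 1}
  one_mem' := θ.refl 1
  mul_mem' hx hy := show θ _ _ by simpa only [one_mul] using hθ.mul hx hy
  isUpperSet' x y h hx := by
    have := hθ.sup hx (θ.refl y)
    rwa [sup_eq_right.2 h, sup_eq_left.2 (le_one y)] at this

theorem rel_inf_of_res_mem (hθ : IsCongruence θ) (h : x ⇒ y ∈ hθ.filter) : θ x (x ⊓ y) := by
  have hmul : θ (x * (x ⇒ y)) x := by simpa only [mul_one] using hθ.mul (θ.refl x) h
  have hinf := hθ.inf hmul (θ.refl y)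
  rw [inf_eq_left.2 (mul_res_le x y)] at hinf
  exact θ.trans (θ.symm hmul) hinf

theorem congruence_filter (hθ : IsCongruence θ) : hθ.filter.congruence = θ := by
  ext x y
  refine ⟨fun ⟨hxy, hyx⟩ ↦ ?_, fun h ↦ ⟨?_, ?_⟩⟩
  · exact θ.trans (hθ.rel_inf_of_res_mem hxy)
      (θ.symm (inf_comm x y ▸ hθ.rel_inf_of_res_mem hyx))
  · exact (res_eq_one_iff.2 (le_refl y) ▸ hθ.res h (θ.refl y) : θ (x ⇒ y) 1)
  · exact (res_eq_one_iff.2 (le_refl y) ▸ hθ.res (θ.refl y) h : θ (y ⇒ x) 1)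

end IsCongruence

theorem isSubdirectlyIrreducible_iff :
    IsSubdirectlyIrreducible A ↔ Subsingleton A ∨
      ∃ c : A, c ≠ 1 ∧ ∀ F : DeductiveFilter A, (∃ x ∈ F, x ≠ 1) → c ∈ F := by
  refine or_congr_right ⟨?_, ?_⟩
  · rintro ⟨μ, hμ, hne, hmin⟩
    obtain ⟨c, hc, hc1⟩ := exists_ne_one_of_congruence_ne_bot (hμ.congruence_filter.symm ▸ hne)
    refine ⟨c, hc1, fun F ⟨x, hx, hx1⟩ ↦ ?_⟩
    exact congruence_one_iff.1 (hmin _ F.isCongruence (congruence_ne_bot hx hx1) hc)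
  · rintro ⟨c, hc1, hc⟩
    refine ⟨(principal c).congruence, (principal c).isCongruence,
      congruence_ne_bot (mem_principal_self c) hc1, fun θ hθ hne ↦ ?_⟩
    rw [← hθ.congruence_filter] at hne ⊢
    exact congruence_mono (principal_le (hc _ (exists_ne_one_of_congruence_ne_bot hne)))

theorem IsSubdirectlyIrreducible.isMTLChain (hA : IsSubdirectlyIrreducible A) : IsMTLChain A := by
  intro x y
  obtain hA | ⟨c, hc1, hc⟩ := isSubdirectlyIrreducible_iff.1 hA
  · exact .inl (Subsingleton.elim x y).le
  by_contra! ⟨hxy, hyx⟩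
  obtain ⟨m, hm⟩ := hc _ ⟨_, mem_principal_self _, mt res_eq_one_iff.1 hxy⟩
  obtain ⟨n, hn⟩ := hc _ ⟨_, mem_principal_self _, mt res_eq_one_iff.1 hyx⟩
  refine hc1 (le_antisymm (le_one c) ?_)
  rw [← pow_sup_pow_eq_one (MTLAlgebra.prelinearity x y) m n]
  exact sup_le hm hn

theorem DeductiveFilter.isSubdirectlyIrreducible_quotient {F : DeductiveFilter A} {c : A}
    (hF : Maximal (fun F : DeductiveFilter A ↦ c ∉ F) F) :
    IsSubdirectlyIrreducible F.Quotient := by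
  refine isSubdirectlyIrreducible_iff.2 (.inr
    ⟨F.toQuotient c, mt F.toQuotient_eq_one_iff.1 hF.prop, ?_⟩)
  rintro G ⟨X, hXG, hX1⟩
  obtain ⟨x, rfl⟩ := F.toQuotient_surjective X
  by_contra hcG
  have hle : F ≤ G.comap F.toQuotient := fun z hz ↦
    (F.toQuotient_eq_one_iff.2 hz ▸ one_mem G : F.toQuotient z ∈ G)
  exact hX1 (F.toQuotient_eq_one_iff.2 (hF.le_of_ge hcG hle hXG))

end SubdirectIrreducibility

section SingleChain

theorem IsMTLChain.exists_filter_pi {A : Type u} [MTLAlgebra A] [Nontrivial A]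
    (hA : IsMTLChain A) :
    ∃ (I : Type u) (F : DeductiveFilter (I → A)),
      IsSubdirectlyIrreducible F.Quotient ∧ ∀ a, Function.const I a ∈ F → a = 1 := by
  let I := {a : A // a ≠ 1}
  let b : I → A := Subtype.val
  let E : DeductiveFilter (I → A) := .eventuallyOne Filter.atTop fun _ ↦ A
  have : Nonempty I := nonempty_subtype.2 (exists_ne 1)
  have : Std.Total (α := I) (· ≤ ·) := ⟨fun i j ↦ hA i j⟩
  have hb : b ∉ E := fun h ↦ let ⟨i, hi⟩ := h.exists; i.2 hi
  obtain ⟨F, hEF, hmax⟩ := DeductiveFilter.exists_ge_maximal_notMem hb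
  refine ⟨I, F, DeductiveFilter.isSubdirectlyIrreducible_quotient hmax, fun a ha ↦ ?_⟩
  by_contra ha1
  have hres : Function.const I a ⇒ b ∈ E :=
    (Filter.eventually_ge_atTop (⟨a, ha1⟩ : I)).mono fun i hi ↦ res_eq_one_iff.2 hi
  exact hmax.prop (DeductiveFilter.mem_of_le (mul_res_le _ b) (mul_mem ha (hEF hres)))

theorem IsMTLChain.exists_isSubdirectlyIrreducible {A : Type u} [MTLAlgebra A]
    (hA : IsMTLChain A) :
    ∃ (B : Type u) (_ : MTLAlgebra B), IsSubdirectlyIrreducible B ∧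
      ∀ φ, Valid B φ ↔ Valid A φ := by
  cases subsingleton_or_nontrivial A
  · exact ⟨A, _, .inl ‹_›, fun _ ↦ Iff.rfl⟩
  obtain ⟨I, F, hF, hconst⟩ := hA.exists_filter_pi
  refine ⟨F.Quotient, inferInstance, hF, fun φ ↦ ⟨?_, fun h ↦ ?_⟩⟩
  · exact (F.isMTLHom_toQuotient.comp isMTLHom_const).valid_of_forall_eq_one
      fun a ha ↦ hconst a (F.toQuotient_eq_one_iff.1 ha)
  · exact F.isMTLHom_toQuotient.valid_of_surjective F.toQuotient_surjective (valid_pi fun _ ↦ h)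

theorem AxiomaticExtension.scc_iff_subSCC {L : AxiomaticExtension} :
    SCC.{u} L ↔ SubSCC.{u} L := by
  constructor
  · rintro ⟨A, _, hA, hchain, hcomp⟩
    obtain ⟨B, _, hB, hvalid⟩ := hchain.exists_isSubdirectlyIrreducible
    exact ⟨B, _, hB, isGeneric_iff.2
      ⟨fun φ hφ ↦ (hvalid φ).2 (hA φ hφ), fun φ ↦ (hcomp φ).trans (hvalid φ).symm⟩⟩
  · rintro ⟨A, _, hsi, hgen⟩
    obtain ⟨hA, hcomp⟩ := isGeneric_iff.1 hgen
    exact ⟨A, _, hA, hsi.isMTLChain, hcomp⟩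

end SingleChain

end MTL

theorem mainTheorem12_general (L : MTL.AxiomaticExtension) :
    ((∀ (A : Type u) [MTL.MTLAlgebra A], L.IsAlgebra A →
        ∀ a : A, (Submonoid.powers a : Set A).Finite) →
      ∃ n : ℕ, 0 < n ∧ L.IsContractive n) ∧
      (MTL.AxiomaticExtension.SCC.{u} L ↔ MTL.AxiomaticExtension.SubSCC.{u} L) :=
  ⟨MTL.AxiomaticExtension.exists_isContractive, MTL.AxiomaticExtension.scc_iff_subSCC⟩

theorem mainTheorem12 (L : MTL.AxiomaticExtension)
    (hL : MTL.AxiomaticExtension.LocallyFiniteVariety.{u} L) :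
    (∃ n : ℕ, 0 < n ∧ L.IsContractive n) ∧
      (MTL.AxiomaticExtension.SCC.{u} L ↔ MTL.AxiomaticExtension.SubSCC.{u} L) :=
  ⟨(mainTheorem12_general L).1 fun A _ hA a ↦ (hL A hA {a} (Set.finite_singleton a)).subset
    fun _ ↦ MTL.MemGenerated.of_mem_powers, (mainTheorem12_general L).2⟩
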